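/- **Setting.** Let $\mathcal X$ be a set, let datasets be $D=(x_1,\dots,x_n)\in\mathcal X^n$, and let $\operatorname{d}:\mathcal X^n\times\mathcal X^n\to[0,\infty)$ be any function. A randomized mechanism $\mathcal A$ on $\mathcal X^n$ is $(\epsilon,\delta)$-DP if $\mathbb P[\mathcal A(D)\in s]\le e^{\epsilon}\,\mathbb P[\mathcal A(D')\in s]+\delta$ for all $D,D'$ with $\operatorname{d}(D,D')\le 1$ and all measurable $s$. The parameters $\theta\in\mathbb R^d$ are the entries of layer matrices $\theta^{[l]}\in\mathbb R^{w_{l-1}\times w_l}$, $l=1,\dots,L$ (so $d=\sum_l w_{l-1}w_l$), and the loss $f(\cdot,x):\mathbb R^d\to\mathbb R$ is Borel measurable for every $x\in\mathcal X$. **Algorithm 1** (Stagewise DP ZO) with direction distribution $\mathbb V$ (a probability measure on $\mathbb R^d$) and noise scale $\sigma\in\mathbb R$. Parameters: $1\le m\le n$, $P\ge1$, $C,\lambda,\beta_0,k>0$, $\eta_0\ge0$, $S,T_0\in\mathbb N$. Start at $\theta^0=\theta$. For $s=1,\dots,S$ put $\beta_s=k\beta_{s-1}$, $T_s=2T_{s-1}$,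 $\eta_s=\eta_{s-1}/2$, set $\theta_0=\theta^{s-1}$, and for $t=1,\dots,T_s$, with fresh independent randomness in each iteration, sample $m$ of the $n$ data points $x_t^1,\dots,x_t^m$ of $D$ uniformly without replacement, $v_t^1,\dots,v_t^P\sim\mathbb V$ and $z_t^1,\dots,z_t^P\sim N(0,\sigma^2C^2)$, all independent, and set $$a_t^{i,p}=\frac{f(\theta_{t-1}+\beta_sv_t^p,x_t^i)-f(\theta_{t-1}-\beta_sv_t^p,x_t^i)}{2\beta_s},\qquad \hat a_t^{i,p}=\frac{a_t^{i,p}}{\max\{1,|a_t^{i,p}|/C\}},$$ $$\theta_t=\theta_{t-1}-\frac{\eta_s}{P}\sum_{p=1}^P\frac1m\Big(\sum_{i=1}^m\big(\hat a_t^{i,p}+\tfrac1\lambda\|\theta_{t-1}-\theta_0\|\big)+z_t^p\Big)v_t^p ,$$ and finally $\theta^s=\theta_{T_s}$. The output is $\theta^S$. **Pruning phase.** Parameters: $r\in(0,1]$, a type (pruning-only or rank-based), reals $A\ge B$, $P'\ge1$, $\beta'>0$. With $\mathcal L(\theta)=\mathbf 1^\top\big(\prod_{l=1}^L|\theta^{[l]}|\big)\mathbf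 1$ (entrywise absolute values) and independent $v_1,\dots,v_{P'}\sim N(0,I_d)$, compute $$\mathrm{Score}=\frac1{P'}\sum_{p=1}^{P'}\frac{\mathcal L(\theta+\beta'v_p)-\mathcal L(\theta-\beta'v_p)}{2\beta'}\,v_p\odot\theta .$$ Let $\mathrm{rank}(i)$ be the number of coordinates whose score is strictly higher than that of $i$. The importance matrix $M$ is diagonal. If $\mathrm{rank}(i)<\lfloor rd\rfloor$, then $M_{ii}=1$ for pruning-only and $M_{ii}=A-(A-B)\,\mathrm{rank}(i)/(rd)$ for rank-based; otherwise $M_{ii}=0$. The resulting direction distribution is $\mathbb V_M$, the law of $Mz$ with $z\sim N(0,I_d)$. **Algorithm 5** (Stagewise DP ZO with pruning) runs the pruning phase at $\theta$ to obtain $M$, then runs Algorithm 1 on $D$ from $\theta$ with direction distribution $\mathbb V_M$ and randomness independent of the pruning phase, and outputs $\theta_{\mathrm{out}}$. **Theorem (privacy of Algorithm 5).** 1. For every $\sigma$, the law of the importance matrix $M$ (hence of $\mathbb V_M$) in an execution of Algorithm 5 on $D$ is the same for all datasets $D$, namely the law of the output of the pruning phase at $\theta$. In particular, releasing $M$ is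 $(0,0)$-DP. 2. For all real $\sigma,\epsilon,\delta$: if, for almost every outcome $M$ of the pruning phase, Algorithm 1 with direction distribution $\mathbb V_M$ is $(\epsilon,\delta)$-DP, then Algorithm 5 is $(\epsilon,\delta)$-DP. So is the mechanism that releases both $M$ and $\theta_{\mathrm{out}}$. 3. In particular, the noise-calibrated guarantee carries over with the same constants. Let $T=\sum_{s=1}^ST_s$ and $c_1,c_2\in\mathbb R$, and call a mechanism depending on $\sigma$ *calibrated* if it is $(\epsilon,\delta)$-DP for all $\epsilon,\delta>0$ and $\sigma$ with $$\epsilon<c_1\frac{m^2T}{n^2},\qquad \sigma^2\ge\frac{c_2^2P^2m^2T\log(P/\delta)}{\epsilon^2n^2}.$$ If Algorithm 1 with $\mathbb V_M$ is calibrated for almost every outcome $M$ of the pruning phase, then Algorithm 5 is calibrated. -/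

import Mathlib

open MeasureTheory ProbabilityTheory
open scoped BigOperators

noncomputable section

namespace DPZO

/-! ### Differential privacy -/

/-- A randomized mechanism `A` (the law of its output, for every dataset) is `(ε, δ)`-differentially
private with respect to the distance `dist` on datasets. -/
def IsDP {𝒟 S : Type*} [MeasurableSpace S] (dist : 𝒟 → 𝒟 → NNReal) (ε δ : ℝ)
    (A : 𝒟 → Measure S) : Prop :=
  (∀ X, IsProbabilityMeasure (A X)) ∧
    ∀ X X', dist X X' ≤ 1 → ∀ s : Set S, MeasurableSet s →
      (A X).real s ≤ Real.exp ε * (A X').real s + δ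

/-! ### Parameters -/

/-- Hyperparameters of the stagewise zeroth-order optimizer for `n` training samples. -/
structure ZOParams (n : ℕ) where
  /-- sample (minibatch) size -/
  m : ℕ
  /-- number of random directions per iteration -/
  P : ℕ
  /-- clipping threshold -/
  C : ℝ
  /-- regularization parameter -/
  lam : ℝ
  /-- initial ZO scale parameter -/
  beta0 : ℝ
  /-- growth factor of the ZO scale parameter -/
  k : ℝ
  /-- number of stages -/
  S : ℕ
  /-- initial iteration number -/
  T0 : ℕ
  /-- initial stepsize -/
  eta0 : ℝ
  m_pos : 0 < m
  m_le : m ≤ n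
  P_pos : 0 < P
  C_pos : 0 < C
  lam_pos : 0 < lam
  beta0_pos : 0 < beta0
  k_pos : 0 < k
  eta0_nonneg : 0 ≤ eta0

/-- The matrix property `type`. -/
inductive MatrixType
  | pruningOnly
  | rankBased

/-- Hyperparameters of the pruning phase. -/
structure PruneParams where
  /-- pruning rate: the ratio of parameters that stay trainable -/
  r : ℝ
  /-- matrix property -/
  type : MatrixType
  /-- upper bound of the rank-based matrix -/
  A : ℝ
  /-- lower bound of the rank-based matrix -/
  B : ℝ
  /-- number of random directions -/
  P : ℕ
  /-- ZO scale parameter -/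
  beta : ℝ
  r_pos : 0 < r
  r_le_one : r ≤ 1
  B_le_A : B ≤ A
  P_pos : 0 < P
  beta_pos : 0 < beta

/-! ### The stagewise DP zeroth-order optimizer -/

section Optimizer

variable {ι X : Type*} [Fintype ι] {n : ℕ}

/-- Two-point zeroth-order estimate on one sample `x`, in direction `v`. -/
def zoDiff (f : EuclideanSpace ℝ ι → X → ℝ) (β : ℝ) (θ v : EuclideanSpace ℝ ι) (x : X) : ℝ :=
  1 / (2 * β) * (f (θ + β • v) x - f (θ - β • v) x)

/-- Clipping to the threshold `C`. -/
def clip (C a : ℝ) : ℝ := a / max 1 (|a| / C)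

/-- The randomness of one iteration: sampled indices, directions, and noises. -/
abbrev IterSeed (ι : Type*) (n m P : ℕ) : Type _ :=
  (Fin m → Fin n) × (Fin P → EuclideanSpace ℝ ι) × (Fin P → ℝ)

/-- One parameter update; `θ₀` is the reference point of the stage, `θ` the current iterate. -/
def update (hp : ZOParams n) (f : EuclideanSpace ℝ ι → X → ℝ) (β η : ℝ) (D : Fin n → X)
    (θ₀ θ : EuclideanSpace ℝ ι) (ω : IterSeed ι n hp.m hp.P) : EuclideanSpace ℝ ι :=
  θ - η • ((1 / (hp.P : ℝ)) • ∑ p : Fin hp.P,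
    (1 / (hp.m : ℝ) *
      ((∑ i : Fin hp.m,
          (clip hp.C (zoDiff f β θ (ω.2.1 p) (D (ω.1 i))) + 1 / hp.lam * ‖θ - θ₀‖))
        + ω.2.2 p)) • ω.2.1 p)

/-- Law of the randomness of one iteration: `m` samples drawn uniformly without replacement,
`P` independent directions from `V`, and `P` independent noises `N(0, σ² C²)`. -/
def iterSeedLaw (hp : ZOParams n) (σ : ℝ) (V : Measure (EuclideanSpace ℝ ι)) :
    Measure (IterSeed ι n hp.m hp.P) :=
  (uniformOn {ξ : Fin hp.m → Fin n | Function.Injective ξ}).prod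
    ((Measure.pi fun _ : Fin hp.P => V).prod
      (Measure.pi fun _ : Fin hp.P => gaussianReal 0 (Real.toNNReal (σ ^ 2 * hp.C ^ 2))))

/-- Law of the iterate after `T` iterations of DP-ZOO started at the reference point `θ₀`. -/
def dpZOO (hp : ZOParams n) (f : EuclideanSpace ℝ ι → X → ℝ) (σ β η : ℝ)
    (V : Measure (EuclideanSpace ℝ ι)) (D : Fin n → X) (θ₀ : EuclideanSpace ℝ ι) :
    (T : ℕ) → Measure (EuclideanSpace ℝ ι)
  | 0 => Measure.dirac θ₀
  | T + 1 => (dpZOO hp f σ β η V D θ₀ T).bind fun θ =>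
      (iterSeedLaw hp σ V).map (update hp f β η D θ₀ θ)

/-- ZO scale parameter of stage `s`: `β_s = k β_{s-1}`. -/
def stageBeta (hp : ZOParams n) : ℕ → ℝ
  | 0 => hp.beta0
  | s + 1 => hp.k * stageBeta hp s

/-- Iteration number of stage `s`: `T_s = 2 T_{s-1}`. -/
def stageT (hp : ZOParams n) : ℕ → ℕ
  | 0 => hp.T0
  | s + 1 => 2 * stageT hp s

/-- Stepsize of stage `s`: `η_s = η_{s-1} / 2`. -/
def stageEta (hp : ZOParams n) : ℕ → ℝ
  | 0 => hp.eta0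
  | s + 1 => stageEta hp s / 2

/-- Law of the parameter returned after the first `s` stages. -/
def stages (hp : ZOParams n) (f : EuclideanSpace ℝ ι → X → ℝ) (σ : ℝ)
    (V : Measure (EuclideanSpace ℝ ι)) (θ₀ : EuclideanSpace ℝ ι) (D : Fin n → X) :
    ℕ → Measure (EuclideanSpace ℝ ι)
  | 0 => Measure.dirac θ₀
  | s + 1 => (stages hp f σ V θ₀ D s).bind fun θ =>
      dpZOO hp f σ (stageBeta hp (s + 1)) (stageEta hp (s + 1)) V D θ (stageT hp (s + 1))

/-- Stagewise DP zeroth-order optimizer with direction distribution `V`, noise scale `σ` and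
initial point `θ₀`: the law of the final parameter, for every dataset. -/
def stagewise (hp : ZOParams n) (f : EuclideanSpace ℝ ι → X → ℝ) (σ : ℝ)
    (V : Measure (EuclideanSpace ℝ ι)) (θ₀ : EuclideanSpace ℝ ι) (D : Fin n → X) :
    Measure (EuclideanSpace ℝ ι) :=
  stages hp f σ V θ₀ D hp.S

/-- Total number of iterations over all stages. -/
def totalIter (hp : ZOParams n) : ℕ := ∑ s ∈ Finset.Icc 1 hp.S, stageT hp s

/-- The noise-calibrated privacy guarantee with constants `c₁`, `c₂`, for a mechanism that depends
on the noise scale `σ`: it is `(ε, δ)`-DP whenever `ε < c₁ m² T / n²` and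
`σ² ≥ c₂² P² m² T log (P / δ) / (ε² n²)`. -/
def CalibratedGuarantee {S : Type*} [MeasurableSpace S] (hp : ZOParams n) (c₁ c₂ : ℝ)
    (dist : (Fin n → X) → (Fin n → X) → NNReal) (A : ℝ → (Fin n → X) → Measure S) : Prop :=
  ∀ σ ε δ : ℝ, 0 < ε → 0 < δ →
    ε < c₁ * (hp.m : ℝ) ^ 2 * totalIter hp / (n : ℝ) ^ 2 →
    c₂ ^ 2 * (hp.P : ℝ) ^ 2 * (hp.m : ℝ) ^ 2 * totalIter hp * Real.log (hp.P / δ)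
        / (ε ^ 2 * (n : ℝ) ^ 2) ≤ σ ^ 2 →
    IsDP dist ε δ (A σ)

end Optimizer

/-! ### Data-free pruning -/

section Pruning

/-- Positions of the weights of a network with `L` layers, the `l`-th of which is a matrix of
size `w l × w (l + 1)`. Parameter vectors have these positions as coordinates. -/
abbrev WeightIdx (L : ℕ) (w : ℕ → ℕ) : Type := Σ l : Fin L, Fin (w l) × Fin (w (l + 1))

/-- The entrywise absolute value of the `l`-th layer. -/
def absLayer {L : ℕ} {w : ℕ → ℕ} (θ : EuclideanSpace ℝ (WeightIdx L w)) (l : Fin L) :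
    Matrix (Fin (w l)) (Fin (w (l + 1))) ℝ :=
  Matrix.of fun a b => |θ ⟨l, a, b⟩|

/-- Product of the first `l` of these matrices. -/
def layerProd {L : ℕ} {w : ℕ → ℕ} (θ : EuclideanSpace ℝ (WeightIdx L w)) :
    (l : ℕ) → l ≤ L → Matrix (Fin (w 0)) (Fin (w l)) ℝ
  | 0, _ => 1
  | l + 1, h => layerProd θ l (Nat.le_of_succ_le h) * absLayer θ ⟨l, h⟩

/-- The data-free loss `1ᵀ (∏ₗ |θ^[l]|) 1`. -/
def pruneLoss {L : ℕ} {w : ℕ → ℕ} (θ : EuclideanSpace ℝ (WeightIdx L w)) : ℝ :=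
  (fun _ => 1) ⬝ᵥ (layerProd θ L le_rfl).mulVec (fun _ => 1)

/-- Synaptic saliency scores computed from the sampled directions `v`. -/
def score {L : ℕ} {w : ℕ → ℕ} (pp : PruneParams) (θ : EuclideanSpace ℝ (WeightIdx L w))
    (v : Fin pp.P → EuclideanSpace ℝ (WeightIdx L w)) (i : WeightIdx L w) : ℝ :=
  1 / (pp.P : ℝ) * ∑ p : Fin pp.P,
    (1 / (2 * pp.beta) *
      (pruneLoss (θ + pp.beta • v p) - pruneLoss (θ - pp.beta • v p)) * v p i) * θ i

variable {ι : Type*} [Fintype ι] [DecidableEq ι]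

/-- Index (from `0`) of the first occurrence of the score of `i` in the list of all scores, sorted
from the highest to the lowest. -/
def scoreRank (s : ι → ℝ) (i : ι) : ℕ := by
  classical exact (Finset.univ.filter fun j => s i < s j).card

/-- The importance matrix. The score of `i` is among the `⌊r d⌋` highest ones iff its rank is
less than `⌊r d⌋`. -/
def importanceMatrix (pp : PruneParams) (s : ι → ℝ) : Matrix ι ι ℝ :=
  Matrix.diagonal fun i =>
    if scoreRank s i < ⌊pp.r * Fintype.card ι⌋₊ then
      match pp.type with
      | .pruningOnly => 1
      | .rankBased => pp.A - (pp.A - pp.B) * scoreRank s i / (pp.r * Fintype.card ι)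
    else 0

/-- The vector distribution `M · N(0, I)`. -/
def directionLaw (M : Matrix ι ι ℝ) : Measure (EuclideanSpace ℝ ι) :=
  (stdGaussian (EuclideanSpace ℝ ι)).map fun z => WithLp.toLp 2 (M.mulVec z.ofLp)

/-- The entrywise (Borel) σ-algebra on matrices. -/
instance instMeasurableSpaceMatrix : MeasurableSpace (Matrix ι ι ℝ) := inferInstanceAs (MeasurableSpace (ι → ι → ℝ))

/-- Data-free zeroth-order pruning: the law of the importance matrix `M`, which encodes the
vector distribution `directionLaw M`. -/
def pruningLaw {L : ℕ} {w : ℕ → ℕ} (pp : PruneParams)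
    (θ : EuclideanSpace ℝ (WeightIdx L w)) :
    Measure (Matrix (WeightIdx L w) (WeightIdx L w) ℝ) :=
  (Measure.pi fun _ : Fin pp.P => stdGaussian (EuclideanSpace ℝ (WeightIdx L w))).map
    fun v => importanceMatrix pp (score pp θ v)

/-- Stagewise DP ZO with pruning, both phases recorded: the joint law of the importance matrix
and of the final parameter. -/
def prunedStagewiseJoint {X : Type*} {n L : ℕ} {w : ℕ → ℕ} (hp : ZOParams n) (pp : PruneParams)
    (f : EuclideanSpace ℝ (WeightIdx L w) → X → ℝ) (σ : ℝ)
    (θ : EuclideanSpace ℝ (WeightIdx L w)) (D : Fin n → X) :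
    Measure (Matrix (WeightIdx L w) (WeightIdx L w) ℝ × EuclideanSpace ℝ (WeightIdx L w)) :=
  (pruningLaw pp θ).bind fun M =>
    (stagewise hp f σ (directionLaw M) θ D).map fun θout => (M, θout)

/-- Stagewise DP ZO with pruning: the law of the final parameter, for every dataset. -/
def prunedStagewise {X : Type*} {n L : ℕ} {w : ℕ → ℕ} (hp : ZOParams n) (pp : PruneParams)
    (f : EuclideanSpace ℝ (WeightIdx L w) → X → ℝ) (σ : ℝ)
    (θ : EuclideanSpace ℝ (WeightIdx L w)) (D : Fin n → X) :
    Measure (EuclideanSpace ℝ (WeightIdx L w)) :=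
  (pruningLaw pp θ).bind fun M => stagewise hp f σ (directionLaw M) θ D

end Pruning

end DPZO

end

namespace DPZO

/-! ### Measurable families of measures -/

section MeasurableFamilies

variable {α β γ : Type*} [MeasurableSpace α] [MeasurableSpace β] [MeasurableSpace γ]

theorem measurable_map_param {κ : α → Measure β} (hκ : Measurable κ)
    (hp : ∀ a, IsProbabilityMeasure (κ a)) {g : α × β → γ} (hg : Measurable g) :
    Measurable fun a => (κ a).map fun b => g (a, b) := by
  let K : Kernel α β := ⟨κ, hκ⟩
  have : IsMarkovKernel K := ⟨hp⟩
  refine Measure.measurable_of_measurable_coe _ fun s hs => ?_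
  have h : ∀ a, (κ a).map (fun b => g (a, b)) s = K a (Prod.mk a ⁻¹' (g ⁻¹' s)) := fun a => by
    rw [Measure.map_apply (f := fun b => g (a, b)) (hg.comp measurable_prodMk_left) hs]
    rfl
  simp_rw [h]
  exact Kernel.measurable_kernel_prodMk_left (hg hs)

theorem measurable_bind_param {κ : α → Measure β} (hκ : Measurable κ)
    (hp : ∀ a, IsProbabilityMeasure (κ a)) {ρ : α × β → Measure γ} (hρ : Measurable ρ) :
    Measurable fun a => (κ a).bind fun b => ρ (a, b) := by
  let K : Kernel α β := ⟨κ, hκ⟩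
  have : IsMarkovKernel K := ⟨hp⟩
  refine Measure.measurable_of_measurable_coe _ fun s hs => ?_
  have h : ∀ a, (κ a).bind (fun b => ρ (a, b)) s = ∫⁻ b, ρ (a, b) s ∂(K a) := fun a => by
    rw [Measure.bind_apply (f := fun b => ρ (a, b)) hs
      (hρ.comp measurable_prodMk_left).aemeasurable]
    rfl
  simp_rw [h]
  exact Measurable.lintegral_kernel_prod_right' ((Measure.measurable_coe hs).comp hρ)

theorem isProbabilityMeasure_bind_of_forall {μ : Measure α} [IsProbabilityMeasure μ]
    {κ : α → Measure β} (hκ : Measurable κ) (hp : ∀ a, IsProbabilityMeasure (κ a)) :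
    IsProbabilityMeasure (μ.bind κ) := by
  constructor
  rw [Measure.bind_apply MeasurableSet.univ hκ.aemeasurable]
  simp

theorem measurable_measure_pi {ι : Type*} [Fintype ι] {κ : α → Measure β} (hκ : Measurable κ)
    (hp : ∀ a, IsProbabilityMeasure (κ a)) :
    Measurable fun a => Measure.pi fun _ : ι => κ a := by
  refine Measurable.measure_of_isPiSystem_of_isProbabilityMeasure generateFrom_pi.symm
    isPiSystem_pi ?_
  rintro _ ⟨s, hs, rfl⟩
  simp_rw [Measure.pi_pi]
  exact Finset.measurable_prod _ fun i _ =>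
    (Measure.measurable_coe (hs i (Set.mem_univ i))).comp hκ

theorem measurable_measure_prod {κ : α → Measure β} {ρ : α → Measure γ} (hκ : Measurable κ)
    (hρ : Measurable ρ) (hpκ : ∀ a, IsProbabilityMeasure (κ a))
    (hpρ : ∀ a, IsProbabilityMeasure (ρ a)) :
    Measurable fun a => (κ a).prod (ρ a) := by
  refine Measurable.measure_of_isPiSystem_of_isProbabilityMeasure generateFrom_prod.symm
    isPiSystem_prod ?_
  rintro _ ⟨s, hs, t, ht, rfl⟩
  simp_rw [Measure.prod_prod]
  exact ((Measure.measurable_coe hs).comp hκ).mul ((Measure.measurable_coe ht).comp hρ)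

end MeasurableFamilies

/-! ### Mixtures of private mechanisms -/

/-- A mixture, over a data-independent law, of almost surely private mechanisms is private. -/
theorem IsDP.bind {𝒟 Ω S : Type*} [MeasurableSpace Ω] [MeasurableSpace S]
    {dist : 𝒟 → 𝒟 → NNReal} {ε δ : ℝ} {μ : Measure Ω} [IsProbabilityMeasure μ]
    {A : Ω → 𝒟 → Measure S} (hA : ∀ X, Measurable fun ω => A ω X)
    (hp : ∀ ω X, IsProbabilityMeasure (A ω X)) (h : ∀ᵐ ω ∂μ, IsDP dist ε δ (A ω)) :
    IsDP dist ε δ fun X => μ.bind fun ω => A ω X := by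
  refine ⟨fun X => isProbabilityMeasure_bind_of_forall (hA X) fun ω => hp ω X,
    fun X X' hX s hs => ?_⟩
  have hm : ∀ X, Measurable fun ω => A ω X s := fun X => (Measure.measurable_coe hs).comp (hA X)
  have hreal : ∀ X, (μ.bind fun ω => A ω X).real s = ∫ ω, (A ω X).real s ∂μ := fun X => by
    rw [measureReal_def, Measure.bind_apply hs (hA X).aemeasurable,
      ← integral_toReal (hm X).aemeasurable (ae_of_all _ fun ω => measure_lt_top _ _)]
    rfl
  have hint : ∀ X, Integrable (fun ω => (A ω X).real s) μ := fun X =>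
    Integrable.of_bound (C := 1) (hm X).ennreal_toReal.aestronglyMeasurable
      (ae_of_all _ fun ω => by
        rw [Real.norm_of_nonneg measureReal_nonneg]
        exact measureReal_le_one)
  rw [hreal, hreal]
  calc ∫ ω, (A ω X).real s ∂μ
      ≤ ∫ ω, (Real.exp ε * (A ω X').real s + δ) ∂μ := by
        refine integral_mono_ae (hint X) (((hint X').const_mul _).add (integrable_const δ)) ?_
        filter_upwards [h] with ω hω using hω.2 X X' hX s hs
    _ = Real.exp ε * ∫ ω, (A ω X').real s ∂μ + δ := by
        rw [integral_add ((hint X').const_mul _) (integrable_const δ), integral_const_mul]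
        simp

/-- Privacy is preserved by measurable post-processing. -/
theorem IsDP.map {𝒟 S S' : Type*} [MeasurableSpace S] [MeasurableSpace S']
    {dist : 𝒟 → 𝒟 → NNReal} {ε δ : ℝ} {A : 𝒟 → Measure S} (h : IsDP dist ε δ A)
    {g : S → S'} (hg : Measurable g) : IsDP dist ε δ fun X => (A X).map g := by
  refine ⟨fun X => ?_, fun X X' hX s hs => ?_⟩
  · have := h.1 X
    exact Measure.isProbabilityMeasure_map hg.aemeasurable
  · rw [map_measureReal_apply hg hs, map_measureReal_apply hg hs]
    exact h.2 X X' hX _ (hg hs)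

/-! ### The stagewise optimizer as a measurable family -/

section Optimizer

variable {ι X : Type*} [Fintype ι] {n : ℕ}

theorem measurable_clip (C : ℝ) : Measurable (clip C) := by
  unfold clip
  fun_prop

theorem measurable_zoDiff_comp {Ω : Type*} [MeasurableSpace Ω]
    {f : EuclideanSpace ℝ ι → X → ℝ} (hf : ∀ x, Measurable fun θ => f θ x) (β : ℝ)
    (D : Fin n → X) {θ v : Ω → EuclideanSpace ℝ ι} {i : Ω → Fin n} (hθ : Measurable θ)
    (hv : Measurable v) (hi : Measurable i) :
    Measurable fun ω => zoDiff f β (θ ω) (v ω) (D (i ω)) := by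
  have key : Measurable fun q : EuclideanSpace ℝ ι × Fin n => f q.1 (D q.2) :=
    measurable_from_prod_countable_left fun j => hf (D j)
  unfold zoDiff
  exact ((key.comp ((hθ.add (hv.const_smul β)).prodMk hi)).sub
    (key.comp ((hθ.sub (hv.const_smul β)).prodMk hi))).const_mul _

theorem measurable_update (hp : ZOParams n) {f : EuclideanSpace ℝ ι → X → ℝ}
    (hf : ∀ x, Measurable fun θ => f θ x) (β η : ℝ) (D : Fin n → X) :
    Measurable fun q : (EuclideanSpace ℝ ι × EuclideanSpace ℝ ι) × IterSeed ι n hp.m hp.P =>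
      update hp f β η D q.1.1 q.1.2 q.2 := by
  have hdir : ∀ p : Fin hp.P, Measurable fun q : (EuclideanSpace ℝ ι × EuclideanSpace ℝ ι) ×
      IterSeed ι n hp.m hp.P => q.2.2.1 p := fun p => by fun_prop
  have hnoise : ∀ p : Fin hp.P, Measurable fun q : (EuclideanSpace ℝ ι × EuclideanSpace ℝ ι) ×
      IterSeed ι n hp.m hp.P => q.2.2.2 p := fun p => by fun_prop
  have hidx : ∀ i : Fin hp.m, Measurable fun q : (EuclideanSpace ℝ ι × EuclideanSpace ℝ ι) ×
      IterSeed ι n hp.m hp.P => q.2.1 i := fun i => by fun_prop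
  have hθ : Measurable fun q : (EuclideanSpace ℝ ι × EuclideanSpace ℝ ι) ×
      IterSeed ι n hp.m hp.P => q.1.2 := by fun_prop
  have hθ₀ : Measurable fun q : (EuclideanSpace ℝ ι × EuclideanSpace ℝ ι) ×
      IterSeed ι n hp.m hp.P => q.1.1 := by fun_prop
  unfold update
  refine hθ.sub (Measurable.fun_const_smul (Measurable.fun_const_smul
    (Finset.measurable_fun_sum _ fun p _ => ?_) _) _)
  refine Measurable.smul (Measurable.const_mul ((Finset.measurable_fun_sum _ fun i _ => ?_).add
    (hnoise p)) _) (hdir p)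
  exact ((measurable_clip _).comp (measurable_zoDiff_comp hf β D hθ (hdir p) (hidx i))).add
    ((hθ.sub hθ₀).norm.const_mul _)

instance isProbabilityMeasure_uniformOn_injective (hp : ZOParams n) :
    IsProbabilityMeasure (uniformOn {ξ : Fin hp.m → Fin n | Function.Injective ξ}) :=
  isProbabilityMeasure_uniformOn (Set.toFinite _)
    ⟨Fin.castLE hp.m_le, Fin.castLE_injective hp.m_le⟩

instance isProbabilityMeasure_iterSeedLaw (hp : ZOParams n) (σ : ℝ)
    (V : Measure (EuclideanSpace ℝ ι)) [IsProbabilityMeasure V] :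
    IsProbabilityMeasure (iterSeedLaw hp σ V) := by
  unfold iterSeedLaw
  infer_instance

variable {α : Type*} [MeasurableSpace α] {V : α → Measure (EuclideanSpace ℝ ι)}

omit [Fintype ι] in
theorem measurable_iterSeedLaw (hp : ZOParams n) (σ : ℝ) (hV : Measurable V)
    (hpV : ∀ a, IsProbabilityMeasure (V a)) :
    Measurable fun a => iterSeedLaw hp σ (V a) := by
  unfold iterSeedLaw
  exact measurable_measure_prod measurable_const
    (measurable_measure_prod (measurable_measure_pi hV hpV) measurable_const
      (fun a => inferInstance) fun a => inferInstance)
    (fun a => inferInstance) fun a => inferInstance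

theorem measurable_updateLaw (hp : ZOParams n) {f : EuclideanSpace ℝ ι → X → ℝ}
    (hf : ∀ x, Measurable fun θ => f θ x) (σ β η : ℝ) (D : Fin n → X) (hV : Measurable V)
    (hpV : ∀ a, IsProbabilityMeasure (V a)) :
    Measurable fun q : (α × EuclideanSpace ℝ ι) × EuclideanSpace ℝ ι =>
      (iterSeedLaw hp σ (V q.1.1)).map (update hp f β η D q.1.2 q.2) :=
  measurable_map_param
    (κ := fun q : (α × EuclideanSpace ℝ ι) × EuclideanSpace ℝ ι => iterSeedLaw hp σ (V q.1.1))
    (g := fun z : ((α × EuclideanSpace ℝ ι) × EuclideanSpace ℝ ι) × IterSeed ι n hp.m hp.P =>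
      update hp f β η D z.1.1.2 z.1.2 z.2)
    ((measurable_iterSeedLaw hp σ hV hpV).comp (measurable_fst.comp measurable_fst))
    (fun _ => inferInstance)
    ((measurable_update hp hf β η D).comp
      (((measurable_snd.comp (measurable_fst.comp measurable_fst)).prodMk
        (measurable_snd.comp measurable_fst)).prodMk measurable_snd))

theorem isProbabilityMeasure_updateLaw (hp : ZOParams n) {f : EuclideanSpace ℝ ι → X → ℝ}
    (hf : ∀ x, Measurable fun θ => f θ x) (σ β η : ℝ) (D : Fin n → X)
    (W : Measure (EuclideanSpace ℝ ι)) [IsProbabilityMeasure W] (θ₀ θ : EuclideanSpace ℝ ι) :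
    IsProbabilityMeasure ((iterSeedLaw hp σ W).map (update hp f β η D θ₀ θ)) :=
  Measure.isProbabilityMeasure_map ((measurable_update hp hf β η D).comp
    (measurable_prodMk_left (x := (θ₀, θ)))).aemeasurable

theorem dpZOO_measurable_and_isProbabilityMeasure (hp : ZOParams n)
    {f : EuclideanSpace ℝ ι → X → ℝ} (hf : ∀ x, Measurable fun θ => f θ x) (σ β η : ℝ)
    (D : Fin n → X) (hV : Measurable V) (hpV : ∀ a, IsProbabilityMeasure (V a)) (T : ℕ) :
    (Measurable fun q : α × EuclideanSpace ℝ ι => dpZOO hp f σ β η (V q.1) D q.2 T) ∧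
      ∀ q : α × EuclideanSpace ℝ ι,
        IsProbabilityMeasure (dpZOO hp f σ β η (V q.1) D q.2 T) := by
  induction T with
  | zero =>
    exact ⟨Measure.measurable_dirac.comp measurable_snd, fun q => Measure.dirac.isProbabilityMeasure⟩
  | succ T ih =>
    have hu := measurable_updateLaw hp hf σ β η D hV hpV
    simp only [dpZOO]
    refine ⟨measurable_bind_param (κ := fun q : α × EuclideanSpace ℝ ι =>
      dpZOO hp f σ β η (V q.1) D q.2 T)
      (ρ := fun z : (α × EuclideanSpace ℝ ι) × EuclideanSpace ℝ ι =>
        (iterSeedLaw hp σ (V z.1.1)).map (update hp f β η D z.1.2 z.2)) ih.1 ih.2 hu,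
      fun q => ?_⟩
    have := ih.2 q
    exact isProbabilityMeasure_bind_of_forall
      (κ := fun θ => (iterSeedLaw hp σ (V q.1)).map (update hp f β η D q.2 θ))
      (hu.comp (measurable_prodMk_left (x := q))) fun θ => isProbabilityMeasure_updateLaw hp hf σ β η D (V q.1) q.2 θ

theorem stages_measurable_and_isProbabilityMeasure (hp : ZOParams n)
    {f : EuclideanSpace ℝ ι → X → ℝ} (hf : ∀ x, Measurable fun θ => f θ x) (σ : ℝ)
    (θ₀ : EuclideanSpace ℝ ι) (D : Fin n → X) (hV : Measurable V)
    (hpV : ∀ a, IsProbabilityMeasure (V a)) (s : ℕ) :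
    (Measurable fun a => stages hp f σ (V a) θ₀ D s) ∧
      ∀ a, IsProbabilityMeasure (stages hp f σ (V a) θ₀ D s) := by
  induction s with
  | zero => exact ⟨measurable_const, fun a => Measure.dirac.isProbabilityMeasure⟩
  | succ s ih =>
    obtain ⟨hd, hdp⟩ := dpZOO_measurable_and_isProbabilityMeasure hp hf σ
      (stageBeta hp (s + 1)) (stageEta hp (s + 1)) D hV hpV (stageT hp (s + 1))
    simp only [stages]
    refine ⟨measurable_bind_param (κ := fun a => stages hp f σ (V a) θ₀ D s)
      (ρ := fun z : α × EuclideanSpace ℝ ι => dpZOO hp f σ (stageBeta hp (s + 1))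
        (stageEta hp (s + 1)) (V z.1) D z.2 (stageT hp (s + 1))) ih.1 ih.2 hd,
      fun a => ?_⟩
    have := ih.2 a
    exact isProbabilityMeasure_bind_of_forall
      (κ := fun θ => dpZOO hp f σ (stageBeta hp (s + 1)) (stageEta hp (s + 1)) (V a) D θ
        (stageT hp (s + 1)))
      (hd.comp (measurable_prodMk_left (x := a))) fun θ => hdp (a, θ)

end Optimizer

/-! ### The pruning phase -/

section Pruning

variable {ι : Type*} [Fintype ι]

theorem measurable_mulVec_toLp :
    Measurable fun q : Matrix ι ι ℝ × EuclideanSpace ℝ ι =>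
      (WithLp.toLp 2 (q.1.mulVec q.2.ofLp) : EuclideanSpace ℝ ι) := by
  refine (WithLp.measurable_toLp 2 (ι → ℝ)).comp (measurable_pi_lambda _ fun i => ?_)
  refine Finset.measurable_fun_sum _ fun j _ => Measurable.mul ?_ ?_
  · exact (measurable_pi_apply j).comp ((measurable_pi_apply i).comp
      (measurable_fst : Measurable fun q : (ι → ι → ℝ) × EuclideanSpace ℝ ι => q.1))
  · fun_prop

theorem measurable_directionLaw :
    Measurable (directionLaw : Matrix ι ι ℝ → Measure (EuclideanSpace ℝ ι)) :=
  measurable_map_param (κ := fun _ : Matrix ι ι ℝ => stdGaussian (EuclideanSpace ℝ ι))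
    measurable_const (fun _ => inferInstance) measurable_mulVec_toLp

instance isProbabilityMeasure_directionLaw (M : Matrix ι ι ℝ) :
    IsProbabilityMeasure (directionLaw M) :=
  Measure.isProbabilityMeasure_map
    (measurable_mulVec_toLp.comp (measurable_prodMk_left (x := M))).aemeasurable

theorem measurable_scoreRank (i : ι) : Measurable fun s : ι → ℝ => scoreRank s i := by
  classical
  have h : (fun s : ι → ℝ => scoreRank s i) = fun s => ∑ j, if s i < s j then 1 else 0 := by
    funext s
    unfold scoreRank
    rw [Finset.card_filter]
  rw [h]
  exact Finset.measurable_fun_sum _ fun j _ => Measurable.ite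
    (measurableSet_lt (measurable_pi_apply i) (measurable_pi_apply j))
    measurable_const measurable_const

theorem measurable_importanceMatrix [DecidableEq ι] (pp : PruneParams) :
    Measurable (importanceMatrix pp : (ι → ℝ) → Matrix ι ι ℝ) := by
  refine measurable_pi_lambda _ fun i => measurable_pi_lambda _ fun j => ?_
  by_cases hij : i = j
  · subst hij
    let g : ℕ → ℝ := fun k =>
      if k < ⌊pp.r * Fintype.card ι⌋₊ then
        match pp.type with
        | .pruningOnly => 1
        | .rankBased => pp.A - (pp.A - pp.B) * k / (pp.r * Fintype.card ι)
      else 0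
    have h : (fun s : ι → ℝ => importanceMatrix pp s i i) = fun s => g (scoreRank s i) := by
      funext s
      exact Matrix.diagonal_apply_eq _ _
    rw [h]
    exact (measurable_of_countable g).comp (measurable_scoreRank i)
  · have h : (fun s : ι → ℝ => importanceMatrix pp s i j) = fun _ => 0 := by
      funext s
      exact Matrix.diagonal_apply_ne _ hij
    rw [h]
    exact measurable_const

variable {L : ℕ} {w : ℕ → ℕ}

theorem measurable_layerProd_apply (l : ℕ) (hl : l ≤ L) (a : Fin (w 0)) (b : Fin (w l)) :
    Measurable fun θ : EuclideanSpace ℝ (WeightIdx L w) => layerProd θ l hl a b := by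
  induction l with
  | zero => exact measurable_const
  | succ l ih =>
    simp only [layerProd, Matrix.mul_apply, absLayer, Matrix.of_apply]
    refine Finset.measurable_fun_sum _ fun c _ => (ih _ c).mul ?_
    fun_prop

theorem measurable_pruneLoss :
    Measurable (pruneLoss : EuclideanSpace ℝ (WeightIdx L w) → ℝ) := by
  unfold pruneLoss
  simp only [dotProduct, Matrix.mulVec]
  refine Finset.measurable_fun_sum _ fun a _ => Measurable.const_mul
    (Finset.measurable_fun_sum _ fun b _ => Measurable.mul_const ?_ _) _
  exact measurable_layerProd_apply L le_rfl a b

theorem measurable_score (pp : PruneParams) (θ : EuclideanSpace ℝ (WeightIdx L w)) :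
    Measurable (score pp θ) := by
  refine measurable_pi_lambda _ fun i => ?_
  unfold score
  have hL : Measurable (pruneLoss : EuclideanSpace ℝ (WeightIdx L w) → ℝ) := measurable_pruneLoss
  fun_prop

instance isProbabilityMeasure_pruningLaw (pp : PruneParams)
    (θ : EuclideanSpace ℝ (WeightIdx L w)) : IsProbabilityMeasure (pruningLaw pp θ) :=
  Measure.isProbabilityMeasure_map
    ((measurable_importanceMatrix pp).comp (measurable_score pp θ)).aemeasurable

end Pruning

/-! ### The pruned optimizer -/

section Pruned

variable {X : Type*} {n L : ℕ} {w : ℕ → ℕ} (hp : ZOParams n) (pp : PruneParams)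
  {f : EuclideanSpace ℝ (WeightIdx L w) → X → ℝ} (hf : ∀ x, Measurable fun θ => f θ x) (σ : ℝ)
  (θ : EuclideanSpace ℝ (WeightIdx L w))

include hf

theorem measurable_stagewise_directionLaw (D : Fin n → X) :
    Measurable fun M => stagewise hp f σ (directionLaw M) θ D :=
  (stages_measurable_and_isProbabilityMeasure hp hf σ θ D measurable_directionLaw
    (fun _ => inferInstance) hp.S).1

theorem isProbabilityMeasure_stagewise_directionLaw (D : Fin n → X)
    (M : Matrix (WeightIdx L w) (WeightIdx L w) ℝ) :
    IsProbabilityMeasure (stagewise hp f σ (directionLaw M) θ D) :=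
  (stages_measurable_and_isProbabilityMeasure hp hf σ θ D measurable_directionLaw
    (fun _ => inferInstance) hp.S).2 M

theorem measurable_stagewise_joint (D : Fin n → X) :
    Measurable fun M => (stagewise hp f σ (directionLaw M) θ D).map fun θout => (M, θout) :=
  measurable_map_param (g := id) (measurable_stagewise_directionLaw hp hf σ θ D)
    (isProbabilityMeasure_stagewise_directionLaw hp hf σ θ D) measurable_id

theorem prunedStagewiseJoint_map_fst (D : Fin n → X) :
    (prunedStagewiseJoint hp pp f σ θ D).map Prod.fst = pruningLaw pp θ := by
  ext s hs
  rw [Measure.map_apply measurable_fst hs, prunedStagewiseJoint,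
    Measure.bind_apply (measurable_fst hs) (measurable_stagewise_joint hp hf σ θ D).aemeasurable,
    ← lintegral_indicator_one hs]
  refine lintegral_congr fun M => ?_
  have := isProbabilityMeasure_stagewise_directionLaw hp hf σ θ D M
  rw [Measure.map_apply measurable_prodMk_left (measurable_fst hs)]
  by_cases hM : M ∈ s
  · have h : Prod.mk M ⁻¹' (Prod.fst ⁻¹' s) =
        (Set.univ : Set (EuclideanSpace ℝ (WeightIdx L w))) := Set.eq_univ_of_forall fun _ => hM
    rw [h, measure_univ, Set.indicator_of_mem hM, Pi.one_apply]
  · have h : Prod.mk M ⁻¹' (Prod.fst ⁻¹' s) =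
        (∅ : Set (EuclideanSpace ℝ (WeightIdx L w))) :=
      Set.eq_empty_of_forall_notMem fun _ h => hM h
    rw [h, measure_empty, Set.indicator_of_notMem hM]

variable {dist : (Fin n → X) → (Fin n → X) → NNReal} {ε δ : ℝ}

theorem isDP_prunedStagewise
    (h : ∀ᵐ M ∂(pruningLaw pp θ), IsDP dist ε δ (stagewise hp f σ (directionLaw M) θ)) :
    IsDP dist ε δ (prunedStagewise hp pp f σ θ) :=
  IsDP.bind (measurable_stagewise_directionLaw hp hf σ θ)
    (fun M D => isProbabilityMeasure_stagewise_directionLaw hp hf σ θ D M) h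

theorem isDP_prunedStagewiseJoint
    (h : ∀ᵐ M ∂(pruningLaw pp θ), IsDP dist ε δ (stagewise hp f σ (directionLaw M) θ)) :
    IsDP dist ε δ (prunedStagewiseJoint hp pp f σ θ) := by
  refine IsDP.bind (measurable_stagewise_joint hp hf σ θ) (fun M D => ?_)
    (h.mono fun M hM => hM.map measurable_prodMk_left)
  have := isProbabilityMeasure_stagewise_directionLaw hp hf σ θ D M
  exact Measure.isProbabilityMeasure_map measurable_prodMk_left.aemeasurable

end Pruned

end DPZO

theorem mainTheorem3 {X : Type*} {n L : ℕ} {w : ℕ → ℕ}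
    (hp : DPZO.ZOParams n) (pp : DPZO.PruneParams)
    (f : EuclideanSpace ℝ (DPZO.WeightIdx L w) → X → ℝ) (hf : ∀ x, Measurable fun θ => f θ x)
    (θ : EuclideanSpace ℝ (DPZO.WeightIdx L w))
    (dist : (Fin n → X) → (Fin n → X) → NNReal) :
    -- the importance matrix (hence the vector distribution) carries no information on the data
    (∀ σ : ℝ,
      (∀ D, (DPZO.prunedStagewiseJoint hp pp f σ θ D).map Prod.fst = DPZO.pruningLaw pp θ) ∧
      DPZO.IsDP dist 0 0 fun D => (DPZO.prunedStagewiseJoint hp pp f σ θ D).map Prod.fst) ∧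
    -- every guarantee of the stagewise optimizer on these distributions carries over to the pruned
    -- algorithm, also if the importance matrix is released along with the final parameter
    (∀ σ ε δ : ℝ,
      (∀ᵐ M ∂(DPZO.pruningLaw pp θ),
        DPZO.IsDP dist ε δ (DPZO.stagewise hp f σ (DPZO.directionLaw M) θ)) →
      DPZO.IsDP dist ε δ (DPZO.prunedStagewise hp pp f σ θ) ∧
      DPZO.IsDP dist ε δ (DPZO.prunedStagewiseJoint hp pp f σ θ)) ∧
    -- in particular the noise-calibrated guarantee, with the same constants
    (∀ c₁ c₂ : ℝ,
      (∀ᵐ M ∂(DPZO.pruningLaw pp θ),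
        DPZO.CalibratedGuarantee hp c₁ c₂ dist
          fun σ => DPZO.stagewise hp f σ (DPZO.directionLaw M) θ) →
      DPZO.CalibratedGuarantee hp c₁ c₂ dist
        fun σ => DPZO.prunedStagewise hp pp f σ θ) := by
  refine ⟨fun σ => ?_, fun σ ε δ h => ⟨DPZO.isDP_prunedStagewise hp pp hf σ θ h,
    DPZO.isDP_prunedStagewiseJoint hp pp hf σ θ h⟩, fun c₁ c₂ h σ ε δ hε hδ h₁ h₂ =>
    DPZO.isDP_prunedStagewise hp pp hf σ θ (h.mono fun M hM => hM σ ε δ hε hδ h₁ h₂)⟩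
  have hfst := DPZO.prunedStagewiseJoint_map_fst hp pp hf σ θ
  refine ⟨hfst, ?_⟩
  simp_rw [hfst]
  exact ⟨fun _ => inferInstance, fun _ _ _ s _ => by simp⟩
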